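/- All graphs are finite and simple. For a connected graph $G$, the rainbow vertex-connection $rvc(G)$ is the smallest number of colors needed to color the vertices of $G$ (not necessarily properly) so that any two vertices are connected by a path whose internal vertices have pairwise distinct colors; for a complete graph no color is needed, and $rvc(G)=0$. Theorem. Let $G$ be a connected graph of order $n$ with minimum degree $\delta$. Then $rvc(G)\le \frac{3n}{4}-2$ if $\delta=3$, $rvc(G)\le \frac{3n}{5}-\frac{8}{5}$ if $\delta=4$, and $rvc(G)\le \frac{n}{2}-2$ if $\delta=5$. Moreover, for every constant $b>2.5$ there is a $\delta_0$, depending only on $b$, such that for every $\delta\ge\delta_0$ every connected graph $G$ of order $n$ with minimum degree $\delta$ satisfies $rvc(G)\le \frac{(b\ln\delta)\,n}{\delta}$. -/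

import Mathlib

universe u

noncomputable section

namespace RainbowVertex

/-- The list of internal vertices of a walk, that is, its vertices without the two ends. -/
def internal {V : Type u} {G : SimpleGraph V} {x y : V} (p : G.Walk x y) : List V :=
  p.support.tail.dropLast

/-- The vertex coloring `c` (not necessarily proper) makes `G` rainbow vertex-connected:
any two vertices are joined by a path whose internal vertices have pairwise distinct colors. -/
def IsRainbowVertexConnected {V : Type u} (G : SimpleGraph V) {C : Type*} (c : V → C) : Prop :=
  ∀ x y : V, ∃ p : G.Walk x y, p.IsPath ∧ ((internal p).map c).Nodup

open Classical in
/-- The rainbow vertex-connection of a (connected) graph: the least number of colors that are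
needed to make it rainbow vertex-connected. In a complete graph no vertex has to be colored, and
by the usual convention the value is `0`. -/
def rvc {V : Type u} (G : SimpleGraph V) : ℕ :=
  if G = ⊤ then 0 else sInf {k : ℕ | ∃ c : V → Fin k, IsRainbowVertexConnected G c}

/-- In a finite connected graph some number of colors suffices, so that the infimum in `rvc` is
a minimum. -/
theorem exists_coloring {V : Type u} [Fintype V] (G : SimpleGraph V) (hG : G.Connected) :
    {k : ℕ | ∃ c : V → Fin k, IsRainbowVertexConnected G c}.Nonempty := by
  classical
  refine ⟨Fintype.card V, Fintype.equivFin V, fun x y => ?_⟩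
  obtain ⟨p, hp⟩ := hG.exists_isPath x y
  refine ⟨p, hp, List.Nodup.map (Fintype.equivFin V).injective ?_⟩
  exact (hp.support_nodup.sublist (List.tail_sublist _)).sublist (List.dropLast_sublist _)

end RainbowVertex

end

/-! Start from one vertex and enlarge a connected set `S` as long as the balance `α |N[S]| - β |S|`
does not fall below its initial value; take `S` of largest size (`exists_connectedOn_of_balance`).
The balance makes `S` small compared with `n`. Maximality puts every undominated vertex next to a
dominated one, gives each dominated vertex few undominated neighbors, and each undominated vertex
few neighbors of its own kind. Coloring `S` injectively, it remains to let undominated vertices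
reach `S`.

For `3 ≤ δ ≤ 5` take `α = 3`, `β = δ + 1`. Dominated vertices then have at most one undominated
neighbor and undominated ones at least two dominated neighbors, so two extra colors suffice. With at
most two undominated vertices, one extra color is enough unless they are so far apart that a
geodesic already forces `n` to be large. For `δ = 3, 5` the last unit comes from parity: a graph of
odd order is not regular of odd degree.

For large `δ` take `α = 4`, `β = δ`. Undominated vertices have at least `δ / 2` dominated neighbors,
so about `2 n ln δ / δ` greedily chosen vertices dominate all but `n / δ` of them. Adding one
dominated neighbor for each of these gives a connected dominating set of size at most `(2 ln δ + 6)
n / δ`. -/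

namespace RainbowVertex

open Finset

/-! ### Rainbow walks through connected sets -/

section Walks

variable {V : Type u} {G : SimpleGraph V}

/-- To make `G` rainbow vertex-connected it is enough to join any two vertices by a walk
that stays, up to its ends, in a set on which the coloring is injective. -/
theorem isRainbowVertexConnected_of_injOn {C : Type*} {c : V → C}
    (h : ∀ x y, x ≠ y → ∃ I : Set V, Set.InjOn c I ∧
      ∃ p : G.Walk x y, ∀ v ∈ p.support, v ∈ I ∨ v = x ∨ v = y) :
    IsRainbowVertexConnected G c := by
  classical
  intro x y
  by_cases hxy : x = y
  · subst hxy
    exact ⟨SimpleGraph.Walk.nil, SimpleGraph.Walk.IsPath.nil, by simp [internal]⟩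
  obtain ⟨I, hI, p, hp⟩ := h x y hxy
  refine ⟨p.bypass, p.bypass_isPath, ?_⟩
  have hnd := p.bypass_isPath.support_nodup
  have hsub : ∀ v ∈ p.bypass.support, v ∈ I ∨ v = x ∨ v = y :=
    fun v hv => hp v (p.support_bypass_subset_support hv)
  -- The shortcut path visits each end only once, so its internal vertices all lie in `I`.
  generalize p.bypass = q at hnd hsub
  cases q with
  | nil => exact absurd rfl hxy
  | cons e r =>
    rw [SimpleGraph.Walk.support_cons] at hnd hsub
    have hint : internal (SimpleGraph.Walk.cons e r) = r.support.dropLast := by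
      simp [internal]
    have hr : r.support = r.support.dropLast ++ [y] := by
      conv_lhs => rw [← List.dropLast_append_getLast r.support_ne_nil]
      rw [SimpleGraph.Walk.getLast_support]
    rw [hint]
    rw [hr] at hnd hsub
    generalize r.support.dropLast = l at hnd hsub
    obtain ⟨hx, hl⟩ := List.nodup_cons.1 hnd
    have hly := List.nodup_append.1 hl
    refine List.Nodup.map_on ?_ hly.1
    have hmem : ∀ v ∈ l, v ∈ I := by
      intro v hv
      rcases hsub v (by simp [hv]) with h | h | h
      · exact h
      · subst h; simp [hv] at hx
      · exact absurd h (hly.2.2 v hv y (by simp))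
    exact fun a ha b hb hab => hI (hmem a ha) (hmem b hb) hab

theorem rvc_le_card {C : Type*} [Fintype C] {c : V → C} (h : IsRainbowVertexConnected G c) :
    rvc G ≤ Fintype.card C := by
  classical
  unfold rvc
  split_ifs
  · exact Nat.zero_le _
  · refine Nat.sInf_le ⟨fun v => Fintype.equivFin C (c v), fun x y => ?_⟩
    obtain ⟨p, hp, hc⟩ := h x y
    refine ⟨p, hp, ?_⟩
    have := hc.map (Fintype.equivFin C).injective
    rwa [List.map_map] at this

variable (G) in
/-- The vertices in `S` induce a nonempty connected subgraph. -/
def ConnectedOn (S : Finset V) : Prop :=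
  S.Nonempty ∧ ∀ a ∈ S, ∀ b ∈ S, ∃ p : G.Walk a b, ∀ v ∈ p.support, v ∈ S

theorem connectedOn_singleton (v : V) : ConnectedOn G {v} := by
  refine ⟨singleton_nonempty v, fun a ha b hb => ?_⟩
  rw [mem_singleton] at ha hb
  subst ha; subst hb
  exact ⟨SimpleGraph.Walk.nil, by simp⟩

variable (G) in
/-- Some walk leads from `x` to `S` through vertices in `E` and `S`. -/
def AttachedThrough (S : Finset V) (x : V) (E : Set V) : Prop :=
  ∃ s ∈ S, ∃ p : G.Walk x s, ∀ v ∈ p.support, v = x ∨ v ∈ E ∨ v ∈ S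

theorem ConnectedOn.exists_walk {S : Finset V} (hS : ConnectedOn G S) {x y : V} {E F : Set V}
    (hx : AttachedThrough G S x E) (hy : AttachedThrough G S y F) :
    ∃ p : G.Walk x y, ∀ v ∈ p.support, v ∈ E ∪ F ∪ S ∨ v = x ∨ v = y := by
  obtain ⟨s, hs, p, hp⟩ := hx
  obtain ⟨t, ht, q, hq⟩ := hy
  obtain ⟨r, hr⟩ := hS.2 s hs t ht
  refine ⟨(p.append r).append q.reverse, fun v hv => ?_⟩
  rw [SimpleGraph.Walk.mem_support_append_iff, SimpleGraph.Walk.mem_support_append_iff,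
    SimpleGraph.Walk.support_reverse, List.mem_reverse] at hv
  simp only [Set.mem_union, Finset.mem_coe]
  rcases hv with (hv | hv) | hv
  · have := hp v hv; tauto
  · have := hr v hv; tauto
  · have := hq v hv; tauto

end Walks

variable {V : Type u} [Fintype V] [DecidableEq V] {G : SimpleGraph V} [DecidableRel G.Adj]

/-! ### Closed neighborhoods -/

variable (G) in
/-- The closed neighborhood of a set of vertices. -/
def cover (S : Finset V) : Finset V := S ∪ S.biUnion fun s => G.neighborFinset s

theorem mem_cover {S : Finset V} {v : V} : v ∈ cover G S ↔ v ∈ S ∨ ∃ s ∈ S, G.Adj s v := by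
  simp [cover]

theorem subset_cover (S : Finset V) : S ⊆ cover G S := fun _ h => mem_cover.2 (Or.inl h)

theorem cover_mono {S T : Finset V} (h : S ⊆ T) : cover G S ⊆ cover G T := by
  intro v hv
  rcases mem_cover.1 hv with hv | ⟨s, hs, hv⟩
  · exact mem_cover.2 (Or.inl (h hv))
  · exact mem_cover.2 (Or.inr ⟨s, h hs, hv⟩)

theorem attachedThrough_of_mem_cover {S : Finset V} {x : V} (h : x ∈ cover G S) :
    AttachedThrough G S x ∅ := by
  rcases mem_cover.1 h with h | ⟨s, hs, hx⟩
  · exact ⟨x, h, SimpleGraph.Walk.nil, by simp⟩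
  · exact ⟨s, hs, hx.symm.toWalk, by simp [hs]⟩

theorem attachedThrough_of_adj {S : Finset V} {x v : V} (h : v ∈ cover G S) (hx : G.Adj x v) :
    AttachedThrough G S x {v} := by
  obtain ⟨s, hs, p, hp⟩ := attachedThrough_of_mem_cover h
  refine ⟨s, hs, SimpleGraph.Walk.cons hx p, fun u hu => ?_⟩
  rw [SimpleGraph.Walk.support_cons, List.mem_cons] at hu
  rcases hu with hu | hu
  · exact Or.inl hu
  · rcases hp u hu with h | h | h
    · exact Or.inr (Or.inl h)
    · exact absurd h (Set.notMem_empty u)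
    · exact Or.inr (Or.inr h)

theorem ConnectedOn.insert_of_mem_cover {S : Finset V} (hS : ConnectedOn G S) {v : V}
    (hv : v ∈ cover G S) : ConnectedOn G (insert v S) := by
  refine ⟨insert_nonempty v S, ?_⟩
  have key : ∀ a ∈ insert v S, AttachedThrough G S a ∅ := by
    intro a ha
    rcases mem_insert.1 ha with rfl | ha
    · exact attachedThrough_of_mem_cover hv
    · exact attachedThrough_of_mem_cover (subset_cover S ha)
  intro a ha b hb
  obtain ⟨p, hp⟩ := hS.exists_walk (key a ha) (key b hb)
  refine ⟨p, fun u hu => ?_⟩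
  rcases hp u hu with h | rfl | rfl
  · simp only [Set.union_empty, Set.empty_union, Finset.mem_coe] at h
    exact mem_insert_of_mem h
  · exact ha
  · exact hb

theorem ConnectedOn.union_of_subset_cover {S : Finset V} (hS : ConnectedOn G S) {T : Finset V}
    (hT : T ⊆ cover G S) : ConnectedOn G (S ∪ T) := by
  induction T using Finset.induction_on with
  | empty => simpa using hS
  | insert v T _ ih =>
    rw [union_insert]
    exact (ih ((subset_insert v T).trans hT)).insert_of_mem_cover
      (cover_mono subset_union_left (hT (mem_insert_self v T)))

/-! ### Colorings built from a connected set -/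

/-- A connected dominating set with pairwise distinct colors suffices. -/
theorem rvc_le_card_of_cover_eq_univ {S : Finset V} (hS : ConnectedOn G S)
    (hc : cover G S = univ) : rvc G ≤ #S := by
  obtain ⟨s₀, hs₀⟩ := hS.1
  -- The color `s₀` outside `S` is a dummy: no vertex there is needed as an internal vertex.
  let c : V → S := fun v => if h : v ∈ S then ⟨v, h⟩ else ⟨s₀, hs₀⟩
  have h : IsRainbowVertexConnected G c := by
    refine isRainbowVertexConnected_of_injOn fun x y _ => ⟨∅ ∪ ∅ ∪ S, ?_, hS.exists_walk
      (attachedThrough_of_mem_cover (by simp [hc])) (attachedThrough_of_mem_cover (by simp [hc]))⟩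
    intro a ha b hb hab
    simp only [Set.union_empty, Set.empty_union, Finset.mem_coe] at ha hb
    simpa [c, ha, hb] using hab
  simpa using rvc_le_card h

/-- One more color suffices if the vertices that `S` leaves undominated form a clique. -/
theorem rvc_le_card_add_one {S : Finset V} (hS : ConnectedOn G S)
    (hadj : ∀ x, x ∉ cover G S → ∃ v ∈ cover G S, G.Adj x v)
    (hclique : ∀ x y, x ∉ cover G S → y ∉ cover G S → x ≠ y → G.Adj x y) :
    rvc G ≤ #S + 1 := by
  -- A single color `none` outside `S` works because each walk below needs at most one internal
  -- vertex there.
  let c : V → Option S := fun v => if h : v ∈ S then some ⟨v, h⟩ else none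
  have hinj : ∀ v, Set.InjOn c (insert v S) := by
    intro v a ha b hb hab
    simp only [Set.mem_insert_iff, Finset.mem_coe] at ha hb
    by_cases h1 : a ∈ S <;> by_cases h2 : b ∈ S <;> simp [c, h1, h2] at hab
    · exact hab
    · rw [ha.resolve_right h1, hb.resolve_right h2]
  have h : IsRainbowVertexConnected G c := by
    refine isRainbowVertexConnected_of_injOn fun x y hxy => ?_
    by_cases hx : x ∈ cover G S
    · by_cases hy : y ∈ cover G S
      · exact ⟨_, (hinj x).mono (by intro; simp; tauto), hS.exists_walk
          (attachedThrough_of_mem_cover hx) (attachedThrough_of_mem_cover hy)⟩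
      · obtain ⟨v, hv, hyv⟩ := hadj y hy
        exact ⟨_, (hinj v).mono (by intro; simp), hS.exists_walk
          (attachedThrough_of_mem_cover hx) (attachedThrough_of_adj hv hyv)⟩
    · by_cases hy : y ∈ cover G S
      · obtain ⟨v, hv, hxv⟩ := hadj x hx
        exact ⟨_, (hinj v).mono (by intro; simp), hS.exists_walk
          (attachedThrough_of_adj hv hxv) (attachedThrough_of_mem_cover hy)⟩
      · exact ⟨∅, Set.injOn_empty c, (hclique x y hx hy hxy).toWalk, by simp⟩
  simpa using rvc_le_card h

/-- Two more colors suffice if each vertex that `S` leaves undominated has two private neighbors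
among the dominated ones. -/
theorem rvc_le_card_add_two {S : Finset V} (hS : ConnectedOn G S)
    (hpriv : ∀ v ∈ cover G S, ∀ x y, x ∉ cover G S → y ∉ cover G S → G.Adj x v → G.Adj y v →
      x = y)
    (hadj : ∀ x, x ∉ cover G S → ∃ a ∈ cover G S, ∃ b ∈ cover G S, a ≠ b ∧ G.Adj x a ∧ G.Adj x b) :
    rvc G ≤ #S + 2 := by
  classical
  choose! f hf g hg hfg hxf hxg using hadj
  have hnS : ∀ v x, x ∉ cover G S → G.Adj x v → v ∉ S :=
    fun v x hx hv h => hx (mem_cover.2 (Or.inr ⟨v, h, hv.symm⟩))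
  -- Of any two undominated vertices, one leaves through its `f`-neighbor and the other through its
  -- `g`-neighbor. Privacy keeps the values of `f` and `g` apart.
  let c : V → S ⊕ Bool := fun v => if h : v ∈ S then Sum.inl ⟨v, h⟩ else
    Sum.inr (decide (∃ x, x ∉ cover G S ∧ v = f x))
  have hcf : ∀ x, x ∉ cover G S → c (f x) = Sum.inr true := by
    intro x hx
    simp only [c, hnS _ x hx (hxf x hx), dite_false, Sum.inr.injEq, decide_eq_true_eq]
    exact ⟨x, hx, rfl⟩
  have hcg : ∀ x, x ∉ cover G S → c (g x) = Sum.inr false := by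
    intro x hx
    simp only [c, hnS _ x hx (hxg x hx), dite_false, Sum.inr.injEq, decide_eq_false_iff_not]
    rintro ⟨y, hy, h⟩
    have hxy : x = y := hpriv (g x) (hg x hx) x y hx hy (hxg x hx) (h ▸ hxf y hy)
    subst hxy
    exact hfg x hx h.symm
  have hcS : ∀ a b, a ∈ S → c a = c b → a = b := by
    intro a b ha hab
    by_cases hb : b ∈ S <;> simp [c, ha, hb] at hab
    exact hab
  have hinj : ∀ x y, x ∉ cover G S → y ∉ cover G S → Set.InjOn c ({f x} ∪ {g y} ∪ S) := by
    intro x y hx hy a ha b hb hab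
    simp only [Set.mem_union, Set.mem_singleton_iff, Finset.mem_coe] at ha hb
    rcases ha with (rfl | rfl) | ha
    · rcases hb with (rfl | rfl) | hb
      · rfl
      · rw [hcf x hx, hcg y hy] at hab; simp at hab
      · exact (hcS b _ hb hab.symm).symm
    · rcases hb with (rfl | rfl) | hb
      · rw [hcf x hx, hcg y hy] at hab; simp at hab
      · rfl
      · exact (hcS b _ hb hab.symm).symm
    · exact hcS a b ha hab
  have h : IsRainbowVertexConnected G c := by
    refine isRainbowVertexConnected_of_injOn fun x y hxy => ?_
    by_cases hx : x ∈ cover G S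
    · by_cases hy : y ∈ cover G S
      · exact ⟨_, fun a ha b _ hab => hcS a b (by simpa using ha) hab, hS.exists_walk
          (attachedThrough_of_mem_cover hx) (attachedThrough_of_mem_cover hy)⟩
      · exact ⟨_, (hinj y y hy hy).mono (by intro; simp; tauto), hS.exists_walk
          (attachedThrough_of_mem_cover hx) (attachedThrough_of_adj (hf y hy) (hxf y hy))⟩
    · by_cases hy : y ∈ cover G S
      · exact ⟨_, (hinj x x hx hx).mono (by intro; simp; tauto), hS.exists_walk
          (attachedThrough_of_adj (hf x hx) (hxf x hx)) (attachedThrough_of_mem_cover hy)⟩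
      · exact ⟨_, hinj x y hx hy, hS.exists_walk
          (attachedThrough_of_adj (hf x hx) (hxf x hx))
          (attachedThrough_of_adj (hg y hy) (hxg y hy))⟩
  simpa using rvc_le_card h

/-! ### Enlarging a connected set -/

theorem neighborFinset_subset_cover {S : Finset V} {v : V} (hv : v ∈ S) :
    G.neighborFinset v ⊆ cover G S := fun u hu =>
  mem_cover.2 (Or.inr ⟨v, hv, (G.mem_neighborFinset v u).1 hu⟩)

theorem notMem_of_adj_of_notMem_cover {S : Finset V} {v w : V} (hw : w ∉ cover G S)
    (h : G.Adj w v) : v ∉ S :=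
  fun hv => hw (mem_cover.2 (Or.inr ⟨v, hv, h.symm⟩))

/-- If not every vertex is dominated by `S` or has a dominated neighbor, then some vertex is at
distance exactly three from `S`. -/
theorem exists_path_of_far (hG : G.Connected) {S : Finset V} (hS : S.Nonempty) {u : V}
    (hu : u ∉ cover G S) (hfar : ∀ v ∈ cover G S, ¬ G.Adj u v) :
    ∃ v ∈ cover G S, ∃ w, w ∉ cover G S ∧ G.Adj w v ∧ ∃ z, z ∉ cover G S ∧ G.Adj w z ∧
      ∀ t ∈ cover G S, ¬ G.Adj z t := by
  obtain ⟨s, hs⟩ := hS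
  -- A walk from `S` to `u` must leave the set of vertices within distance two of `S`; the edge
  -- where it does so gives `w` and `z`.
  obtain ⟨p⟩ := hG.preconnected s u
  obtain ⟨d, -, h1, h2⟩ := p.exists_boundary_dart
    {x | x ∈ cover G S ∨ ∃ v ∈ cover G S, G.Adj x v} (Or.inl (subset_cover S hs))
    (by rintro (h | ⟨v, hv, h⟩); exacts [hu h, hfar v hv h])
  simp only [Set.mem_ofPred_eq, not_or, not_exists, not_and] at h1 h2
  have hw : d.fst ∉ cover G S := fun h => h2.2 _ h d.adj.symm
  obtain ⟨v, hv, hwv⟩ := h1.resolve_left hw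
  exact ⟨v, hv, d.fst, hw, hwv, d.snd, h2.1, d.adj, h2.2⟩

/-- A connected set can be enlarged, without loss in the balance `α |N[S]| - β |S|`, until adding
one, two or three vertices would decrease this balance. -/
theorem exists_connectedOn_of_balance {α β δ : ℕ} (hG : G.Connected)
    (hδ : ∀ v, δ ≤ G.degree v) (hβ : 0 < β) (hαβ : 3 * β ≤ α * (δ + 1)) {S₀ : Finset V}
    (h₀ : ConnectedOn G S₀) :
    ∃ S, ConnectedOn G S ∧ α * #(cover G S₀) + β * #S ≤ α * #(cover G S) + β * #S₀ ∧
      (∀ v ∈ cover G S, α * #(G.neighborFinset v \ cover G S) < β) ∧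
      ∀ w, w ∉ cover G S → (∃ v ∈ cover G S, G.Adj w v) ∧
        α * (#(G.neighborFinset w \ cover G S) + 1) < 2 * β := by
  classical
  -- The size is maximized, not the balance, so every proper connected enlargement strictly loses
  -- balance; hence the strict inequalities.
  obtain ⟨S, hSP, hmax⟩ := (univ.filter fun S => ConnectedOn G S ∧
    α * #(cover G S₀) + β * #S ≤ α * #(cover G S) + β * #S₀).exists_max_image card
    ⟨S₀, by simp [h₀]⟩
  simp only [mem_filter, mem_univ, true_and] at hSP hmax
  obtain ⟨hS, hbal⟩ := hSP
  have step : ∀ S' X k, ConnectedOn G S' → S ⊆ S' → #S' = #S + k → 0 < k →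
      X ⊆ cover G S' → Disjoint (cover G S) X → α * #X < β * k := by
    intro S' X k hS' hSS' hk hk0 hX hdisj
    by_contra! hcon
    have hcard : #(cover G S) + #X ≤ #(cover G S') := by
      rw [← card_union_of_disjoint hdisj]
      exact card_le_card (union_subset (cover_mono hSS') hX)
    have h1 := Nat.mul_le_mul_left α hcard
    have h2 := hmax S' ⟨hS', by rw [hk]; nlinarith⟩
    omega
  have hnear : ∀ w, w ∉ cover G S → ∃ v ∈ cover G S, G.Adj w v := by
    intro u hu
    by_contra! hcon
    obtain ⟨v, hv, w, hw, hwv, z, hz, hwz, hfar⟩ := exists_path_of_far hG hS.1 hu hcon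
    have hvS := notMem_of_adj_of_notMem_cover hw hwv
    have hwS : w ∉ insert v S := by
      rw [mem_insert, not_or]
      exact ⟨hwv.ne, fun h => hw (subset_cover S h)⟩
    have hzS : z ∉ insert w (insert v S) := by
      rw [mem_insert, mem_insert, not_or, not_or]
      exact ⟨hwz.ne', fun h => hz (h ▸ hv), fun h => hz (subset_cover S h)⟩
    have hw' : w ∈ cover G (insert v S) :=
      mem_cover.2 (Or.inr ⟨v, mem_insert_self v S, hwv.symm⟩)
    have hz' : z ∈ cover G (insert w (insert v S)) :=
      mem_cover.2 (Or.inr ⟨w, mem_insert_self w _, hwz⟩)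
    -- Three new vertices dominate all of `N[z]`, at least `δ + 1` new vertices, against `3 * β ≤ α
    -- * (δ + 1)`.
    have := step (insert z (insert w (insert v S))) (insert z (G.neighborFinset z)) 3
      (((hS.insert_of_mem_cover hv).insert_of_mem_cover hw').insert_of_mem_cover hz')
      (by intro a ha; simp [ha])
      (by rw [card_insert_of_notMem hzS, card_insert_of_notMem hwS, card_insert_of_notMem hvS])
      (by norm_num)
      (insert_subset (subset_cover _ (mem_insert_self z _))
        (neighborFinset_subset_cover (mem_insert_self z _)))
      (by
        rw [disjoint_left]
        intro t ht htz
        rcases mem_insert.1 htz with rfl | htz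
        · exact hz ht
        · exact hfar t ht ((G.mem_neighborFinset z t).1 htz))
    rw [card_insert_of_notMem (by simp), G.card_neighborFinset_eq_degree] at this
    have h1 := Nat.mul_le_mul_left α (Nat.add_le_add_right (hδ z) 1)
    omega
  refine ⟨S, hS, hbal, fun v hv => ?_, fun w hw => ⟨hnear w hw, ?_⟩⟩
  · by_cases hvS : v ∈ S
    · rw [sdiff_eq_empty_iff_subset.2 (neighborFinset_subset_cover hvS)]
      simpa using hβ
    · simpa using step (insert v S) (G.neighborFinset v \ cover G S) 1
        (hS.insert_of_mem_cover hv) (subset_insert v S) (card_insert_of_notMem hvS) one_pos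
        (sdiff_subset.trans (neighborFinset_subset_cover (mem_insert_self v S))) disjoint_sdiff
  · obtain ⟨v, hv, hwv⟩ := hnear w hw
    have hvS := notMem_of_adj_of_notMem_cover hw hwv
    have hwS : w ∉ insert v S := by
      rw [mem_insert, not_or]
      exact ⟨hwv.ne, fun h => hw (subset_cover S h)⟩
    have := step (insert w (insert v S)) (insert w (G.neighborFinset w \ cover G S)) 2
      ((hS.insert_of_mem_cover hv).insert_of_mem_cover
        (mem_cover.2 (Or.inr ⟨v, mem_insert_self v S, hwv.symm⟩)))
      (by intro a ha; simp [ha])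
      (by rw [card_insert_of_notMem hwS, card_insert_of_notMem hvS])
      (by norm_num)
      (insert_subset (subset_cover _ (mem_insert_self w _))
        (sdiff_subset.trans (neighborFinset_subset_cover (mem_insert_self w _))))
      (by
        rw [disjoint_insert_right]
        exact ⟨hw, disjoint_sdiff⟩)
    rw [card_insert_of_notMem (by simp)] at this
    omega

/-! ### Geodesics -/

/-- A vertex lies in the closed neighborhoods of at most three vertices of a geodesic. -/
theorem dist_add_one_mul_le {δ : ℕ} (hG : G.Connected) (hδ : ∀ v, δ ≤ G.degree v) (x y : V) :
    (G.dist x y + 1) * (δ + 1) ≤ 3 * Fintype.card V := by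
  obtain ⟨p, hp⟩ := hG.exists_walk_length_eq_dist x y
  have hdist : ∀ i ≤ p.length, G.dist x (p.getVert i) = i := by
    intro i hi
    have h1 := SimpleGraph.dist_le (p.take i)
    have h2 := SimpleGraph.dist_le (p.drop i)
    have h3 := hG.dist_triangle (u := x) (v := p.getVert i) (w := y)
    rw [SimpleGraph.Walk.take_length] at h1
    rw [SimpleGraph.Walk.drop_length] at h2
    omega
  have key := card_mul_le_card_mul (s := range (p.length + 1)) (t := (univ : Finset V))
    (m := δ + 1) (n := 3) (fun i v => v = p.getVert i ∨ G.Adj (p.getVert i) v) ?_ ?_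
  · rw [card_range, card_univ, hp] at key
    omega
  · intro i _
    have : univ.bipartiteAbove (fun i v => v = p.getVert i ∨ G.Adj (p.getVert i) v) i =
        insert (p.getVert i) (G.neighborFinset (p.getVert i)) := by
      ext v
      simp [mem_bipartiteAbove]
    rw [this, card_insert_of_notMem (by simp), G.card_neighborFinset_eq_degree]
    exact Nat.add_le_add_right (hδ _) 1
  · intro v _
    refine (card_le_card (t := Icc (G.dist x v - 1) (G.dist x v + 1)) ?_).trans ?_
    · intro i hi
      rw [mem_bipartiteBelow, mem_range] at hi
      have hi' := hdist i (by omega)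
      rw [mem_Icc]
      rcases hi.2 with rfl | h
      · omega
      · have h1 := hG.dist_triangle (u := x) (v := p.getVert i) (w := v)
        have h2 := hG.dist_triangle (u := x) (v := v) (w := p.getVert i)
        rw [SimpleGraph.dist_eq_one_iff_adj.2 h] at h1
        rw [SimpleGraph.dist_eq_one_iff_adj.2 h.symm] at h2
        omega
    · rw [Nat.card_Icc]
      omega

/-- One more color suffices if `S` leaves just two vertices undominated and a geodesic between
them is not too long. -/
theorem rvc_le_card_add_one_of_dist_le (hG : G.Connected) {S : Finset V} (hS : ConnectedOn G S)
    {x y : V} (hxy : x ≠ y) (hnadj : ¬ G.Adj x y)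
    (hO : ∀ z, z ∉ cover G S → z = x ∨ z = y)
    (hy : ∃ a ∈ cover G S, ∃ b ∈ cover G S, a ≠ b ∧ G.Adj y a ∧ G.Adj y b)
    (hdist : G.dist x y ≤ #S + 2) : rvc G ≤ #S + 1 := by
  classical
  obtain ⟨p, hp⟩ := hG.exists_walk_length_eq_dist x y
  have hcover : ∀ z, z ≠ x → z ≠ y → z ∈ cover G S := by
    intro z h1 h2
    by_contra h
    rcases hO z h with h | h
    exacts [h1 h, h2 h]
  have hpos : 0 < p.length := by
    rw [hp]
    exact hG.pos_dist_of_ne hxy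
  have hxv : G.Adj x (p.getVert 1) := by
    simpa using p.adj_getVert_succ hpos
  have hv : p.getVert 1 ∈ cover G S := hcover _ hxv.ne' (fun h => hnadj (h ▸ hxv))
  set v := p.getVert 1 with hv_def
  -- A dominated neighbor of `y` other than the next-to-last vertex of the geodesic is off the
  -- geodesic, so its color stays free to choose.
  obtain ⟨w, hw, hyw, hwp⟩ : ∃ w ∈ cover G S, G.Adj y w ∧ w ≠ p.getVert (p.length - 1) := by
    obtain ⟨a, ha, b, hb, hab, hya, hyb⟩ := hy
    by_cases h : a = p.getVert (p.length - 1)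
    · exact ⟨b, hb, hyb, fun h' => hab (h.trans h'.symm)⟩
    · exact ⟨a, ha, hya, h⟩
  let J : Finset V := (p.support.toFinset.erase x).erase y
  have hJcard : #J ≤ #S + 1 := by
    have h1 : #p.support.toFinset ≤ p.length + 1 := by
      rw [← p.length_support]
      exact List.toFinset_card_le _
    have h2 : #(p.support.toFinset.erase x) + 1 = #p.support.toFinset :=
      card_erase_add_one (by simp)
    have h3 : #J + 1 = #(p.support.toFinset.erase x) :=
      card_erase_add_one (by simp [hxy.symm])
    omega
  have hwJ : w ∉ J := by
    intro h
    have hws : w ∈ p.support := by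
      simp only [J, mem_erase, List.mem_toFinset] at h
      exact h.2.2
    obtain ⟨i, hi, hil⟩ := SimpleGraph.Walk.mem_support_iff_exists_getVert.1 hws
    have h1 := SimpleGraph.dist_le (p.take i)
    rw [SimpleGraph.Walk.take_length, hi] at h1
    have h2 := hG.dist_triangle (u := x) (v := w) (w := y)
    rw [SimpleGraph.dist_eq_one_iff_adj.2 hyw.symm] at h2
    have h3 : i ≠ p.length - 1 := fun h => hwp (by rw [← h, hi])
    have h4 : i = p.length := by omega
    rw [h4, p.getVert_length] at hi
    exact hyw.ne hi
  let c₀ : V → Option S := fun v => if h : v ∈ S then some ⟨v, h⟩ else none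
  have hinj : ∀ v, Set.InjOn c₀ (insert v S) := by
    intro v a ha b hb hab
    simp only [Set.mem_insert_iff, Finset.mem_coe] at ha hb
    by_cases h1 : a ∈ S <;> by_cases h2 : b ∈ S <;> simp [c₀, h1, h2] at hab
    · exact hab
    · rw [ha.resolve_right h1, hb.resolve_right h2]
  have hinjv : Set.InjOn (fun z : J => c₀ z)
      (univ.filter fun z : J => (z : V) ∈ insert v S) := by
    intro a ha b hb hab
    refine Subtype.ext (hinj v ?_ ?_ hab)
    · simpa using ha
    · simpa using hb
  -- The interior `J` of the geodesic has at most `#S + 1` vertices, so the colors that `c₀` gives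
  -- to its part in `insert v S` extend to an injective coloring of `J`.
  obtain ⟨t, hft, ht⟩ := exists_superset_card_eq (n := #J)
    (s := image (fun z : J => c₀ z) (univ.filter fun z : J => (z : V) ∈ insert v S))
    (by
      refine card_image_le.trans ((card_filter_le _ _).trans ?_)
      simp)
    (by simpa using hJcard)
  obtain ⟨g, hg⟩ := exists_equiv_extend_of_card_eq (by simpa using ht.symm) hft hinjv
  let c : V → Option S := fun z => if h : z ∈ J then g ⟨z, h⟩ else c₀ z
  have hcJ : Set.InjOn c J := by
    intro a ha b hb hab
    simp only [Finset.mem_coe] at ha hb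
    simp only [c, ha, hb, dite_true] at hab
    simpa using g.injective (Subtype.ext hab)
  have hcv : ∀ z, z ∈ insert v S → c z = c₀ z := by
    intro z hz
    by_cases h : z ∈ J
    · simp only [c, h, dite_true]
      exact hg ⟨z, h⟩ (by simpa using hz)
    · simp [c, h]
  have hcw : ∀ z, z ∈ insert w S → c z = c₀ z := by
    intro z hz
    rcases mem_insert.1 hz with rfl | hz
    · simp [c, hwJ]
    · exact hcv z (mem_insert_of_mem hz)
  have hinj_v : Set.InjOn c (insert v S : Finset V) := fun a ha b hb hab =>
    hinj v (by simpa using ha) (by simpa using hb)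
      (by rw [← hcv a (by simpa using ha), ← hcv b (by simpa using hb), hab])
  have hinj_w : Set.InjOn c (insert w S : Finset V) := fun a ha b hb hab =>
    hinj w (by simpa using ha) (by simpa using hb)
      (by rw [← hcw a (by simpa using ha), ← hcw b (by simpa using hb), hab])
  have hpJ : ∀ z ∈ p.support, z ∈ (J : Set V) ∨ z = x ∨ z = y := by
    intro z hz
    simp only [J, Finset.mem_coe, mem_erase, List.mem_toFinset]
    tauto
  have hatt : ∀ z, z ≠ x → z ≠ y → AttachedThrough G S z ∅ := fun z h1 h2 =>
    attachedThrough_of_mem_cover (hcover z h1 h2)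
  have hattx : AttachedThrough G S x {v} := attachedThrough_of_adj hv hxv
  have hatty : AttachedThrough G S y {w} := attachedThrough_of_adj hw hyw
  have h : IsRainbowVertexConnected G c := by
    refine isRainbowVertexConnected_of_injOn fun a b hab => ?_
    by_cases hax : a = x
    · subst hax
      by_cases hby : b = y
      · subst hby
        exact ⟨J, hcJ, p, hpJ⟩
      · exact ⟨_, hinj_v.mono (by intro; simp), hS.exists_walk hattx (hatt b hab.symm hby)⟩
    by_cases hay : a = y
    · subst hay
      by_cases hbx : b = x
      · subst hbx
        refine ⟨J, hcJ, p.reverse, fun z hz => ?_⟩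
        rw [SimpleGraph.Walk.support_reverse, List.mem_reverse] at hz
        have := hpJ z hz
        tauto
      · exact ⟨_, hinj_w.mono (by intro; simp), hS.exists_walk hatty (hatt b hbx hab.symm)⟩
    have ha := hatt a hax hay
    by_cases hbx : b = x
    · subst hbx
      exact ⟨_, hinj_v.mono (by intro; simp), hS.exists_walk ha hattx⟩
    by_cases hby : b = y
    · subst hby
      exact ⟨_, hinj_w.mono (by intro; simp), hS.exists_walk ha hatty⟩
    exact ⟨_, hinj_v.mono (by intro; simp; tauto), hS.exists_walk ha (hatt b hbx hby)⟩
  simpa using rvc_le_card h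

theorem exists_two_neighbors_mem_cover {S : Finset V} {w : V}
    (h : #(G.neighborFinset w \ cover G S) + 2 ≤ G.degree w) :
    ∃ a ∈ cover G S, ∃ b ∈ cover G S, a ≠ b ∧ G.Adj w a ∧ G.Adj w b := by
  have h1 : 1 < #(G.neighborFinset w ∩ cover G S) := by
    have := card_sdiff_add_card_inter (G.neighborFinset w) (cover G S)
    rw [G.card_neighborFinset_eq_degree] at this
    omega
  obtain ⟨a, ha, b, hb, hab⟩ := one_lt_card.1 h1
  simp only [mem_inter, G.mem_neighborFinset] at ha hb
  exact ⟨a, ha.2, b, hb.2, hab, ha.1, hb.1⟩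

/-! ### Minimum degree three, four and five -/

/-- Bounds for small minimum degree in terms of the degree of a single vertex. -/
theorem rvc_bounds_of_degree {δ : ℕ} (hG : G.Connected) (hδ : ∀ v, δ ≤ G.degree v)
    (h3 : 3 ≤ δ) (h5 : δ ≤ 5) (v₀ : V) :
    (δ + 1) * rvc G + 3 * G.degree v₀ + 6 ≤ 3 * Fintype.card V + 2 * (δ + 1) ∨
    (δ + 1) * rvc G + 3 * G.degree v₀ + 12 ≤ 3 * Fintype.card V + 3 * (δ + 1) ∨
    (δ + 1) * rvc G + 2 * (δ + 1) ≤ 3 * Fintype.card V := by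
  obtain ⟨S, hS, hbal, hin, hout⟩ := exists_connectedOn_of_balance (α := 3) (β := δ + 1) hG hδ
    (Nat.succ_pos δ) le_rfl (connectedOn_singleton v₀)
  have hcov₀ : cover G {v₀} = insert v₀ (G.neighborFinset v₀) := by
    ext; simp [cover]
  rw [hcov₀, card_insert_of_notMem (by simp), G.card_neighborFinset_eq_degree, card_singleton,
    mul_one] at hbal
  have hpriv : ∀ v ∈ cover G S, ∀ x y, x ∉ cover G S → y ∉ cover G S → G.Adj x v → G.Adj y v →
      x = y := by
    intro v hv x y hx hy hxv hyv
    have := hin v hv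
    have h1 : #(G.neighborFinset v \ cover G S) ≤ 1 := by omega
    exact card_le_one.1 h1 x (by simp [hx, hxv.symm]) y (by simp [hy, hyv.symm])
  have hadj : ∀ w, w ∉ cover G S →
      ∃ a ∈ cover G S, ∃ b ∈ cover G S, a ≠ b ∧ G.Adj w a ∧ G.Adj w b := by
    intro w hw
    have h1 := (hout w hw).2
    have h2 := hδ w
    exact exists_two_neighbors_mem_cover (by omega)
  have hcard := card_add_card_compl (cover G S)
  have h2 : rvc G ≤ #S + 2 := rvc_le_card_add_two hS hpriv hadj
  have hm1 : rvc G ≤ #S + 1 → (δ + 1) * rvc G ≤ (δ + 1) * #S + (δ + 1) := fun h => by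
    simpa [mul_add] using Nat.mul_le_mul_left (δ + 1) h
  have hm2 : (δ + 1) * rvc G ≤ (δ + 1) * #S + 2 * (δ + 1) := by
    have := Nat.mul_le_mul_left (δ + 1) h2
    rw [mul_add] at this
    omega
  have hmem : ∀ z, z ∈ (cover G S)ᶜ ↔ z ∉ cover G S := fun z => mem_compl
  rcases Nat.lt_or_ge 2 (#(cover G S)ᶜ) with hO | hO
  · right; left
    omega
  by_cases hclique : ∀ x y, x ∉ cover G S → y ∉ cover G S → x ≠ y → G.Adj x y
  · left
    rcases (cover G S)ᶜ.eq_empty_or_nonempty with hem | hne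
    · have h0 := rvc_le_card_of_cover_eq_univ hS (by simpa using hem)
      have h0' := Nat.mul_le_mul_left (δ + 1) h0
      rw [hem, card_empty] at hcard
      omega
    · have h1 := hm1 (rvc_le_card_add_one hS (fun x hx => (hout x hx).1) hclique)
      have := hne.card_pos
      omega
  · push Not at hclique
    obtain ⟨x, y, hx, hy, hxy, hnadj⟩ := hclique
    have hsub : {x, y} ⊆ (cover G S)ᶜ := by
      intro z hz
      rcases mem_insert.1 hz with rfl | hz
      · exact mem_compl.2 hx
      · rw [mem_singleton.1 hz]
        exact mem_compl.2 hy
    have hpair := eq_of_subset_of_card_le hsub (by rw [card_pair hxy]; exact hO)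
    rcases le_or_gt (G.dist x y) (#S + 2) with hd | hd
    · left
      have h1 := hm1 (rvc_le_card_add_one_of_dist_le hG hS hxy hnadj
        (fun z hz => by
          have : z ∈ ({x, y} : Finset V) := by rw [hpair]; exact mem_compl.2 hz
          simpa using this) (hadj y hy) hd)
      rw [← hpair, card_pair hxy] at hcard
      omega
    -- A geodesic with at least `#S + 4` vertices forces `(#S + 4) * (δ + 1) ≤ 3 * n`, so even `#S +
    -- 2` colors are within the bound.
    · right; right
      have h1 := dist_add_one_mul_le hG hδ x y
      have h3' : (#S + 4) * (δ + 1) ≤ (G.dist x y + 1) * (δ + 1) :=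
        Nat.mul_le_mul_right _ (by omega)
      have h4 : (#S + 4) * (δ + 1) = (δ + 1) * #S + 4 * (δ + 1) := by ring
      omega

omit [DecidableEq V] in
/-- A graph of odd order whose minimum degree is odd is not regular. -/
theorem exists_lt_degree_of_odd {δ : ℕ} (hδ : ∀ v, δ ≤ G.degree v) (hodd : Odd δ)
    (hn : Odd (Fintype.card V)) : ∃ v, δ < G.degree v := by
  by_contra! h
  have h1 := G.sum_degrees_eq_twice_card_edges
  rw [sum_congr rfl fun v _ => le_antisymm (h v) (hδ v), sum_const, card_univ, smul_eq_mul] at h1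
  have h2 := hn.mul hodd
  rw [h1] at h2
  exact Nat.not_odd_iff_even.2 (even_two_mul _) h2

omit [DecidableEq V] in
/-- If `δ` is odd, then some vertex has degree exceeding `δ` in case the order is odd too. -/
theorem exists_degree_parity [Nonempty V] {δ : ℕ} (hδ : ∀ v, δ ≤ G.degree v) (hodd : Odd δ) :
    ∃ v, δ ≤ G.degree v ∧ (Fintype.card V % 2 = 1 → δ < G.degree v) := by
  rcases Nat.even_or_odd (Fintype.card V) with h | h
  · obtain ⟨v⟩ := ‹Nonempty V›
    exact ⟨v, hδ v, fun h' => by rw [Nat.even_iff] at h; omega⟩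
  · obtain ⟨v, hv⟩ := exists_lt_degree_of_odd hδ hodd h
    exact ⟨v, hv.le, fun _ => hv⟩

/-- At a vertex of degree three the first alternative only yields `4 * rvc G + 7 ≤ 3 * n`. For even
`n` parity improves this by one; for odd `n` some vertex has larger degree. The case of degree five
gains its missing unit in the same way. -/
theorem rvc_le_of_three_le_degree (hG : G.Connected) (hδ : ∀ v, 3 ≤ G.degree v) :
    4 * rvc G + 8 ≤ 3 * Fintype.card V := by
  have := hG.nonempty
  obtain ⟨v, hv, hv'⟩ := exists_degree_parity hδ (by decide)
  have := rvc_bounds_of_degree hG hδ le_rfl (by norm_num) v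
  omega

theorem rvc_le_of_four_le_degree (hG : G.Connected) (hδ : ∀ v, 4 ≤ G.degree v) :
    5 * rvc G + 8 ≤ 3 * Fintype.card V := by
  obtain ⟨v⟩ := hG.nonempty
  have := hδ v
  have := rvc_bounds_of_degree hG hδ (by norm_num) (by norm_num) v
  omega

theorem rvc_le_of_five_le_degree (hG : G.Connected) (hδ : ∀ v, 5 ≤ G.degree v) :
    2 * rvc G + 4 ≤ Fintype.card V := by
  have := hG.nonempty
  obtain ⟨v, hv, hv'⟩ := exists_degree_parity hδ (by decide)
  have := rvc_bounds_of_degree hG hδ (by norm_num) le_rfl v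
  omega

/-! ### Large minimum degree -/

/-- Greedy domination: if each vertex in `B` has at least `d` neighbors in `A`, then each new
vertex of `A` can be chosen to dominate a proportion `d / n` of what is left of `B`. -/
theorem exists_dominating_greedy {W : Type*} [DecidableEq W] (r : W → W → Prop)
    [DecidableRel r] (A B : Finset W) {n d : ℝ} (hA : (#A : ℝ) ≤ n) (hd0 : 0 < d)
    (hdn : d ≤ n) (hd : ∀ b ∈ B, d ≤ #(A.filter (r b))) (k : ℕ) :
    ∃ T ⊆ A, #T ≤ k ∧ (#(B.filter fun b => ∀ t ∈ T, ¬ r b t) : ℝ) ≤ #B * (1 - d / n) ^ k := by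
  have hn : 0 < n := hd0.trans_le hdn
  induction k with
  | zero => exact ⟨∅, empty_subset A, by simp, by simp⟩
  | succ k ih =>
    obtain ⟨T, hTA, hTk, hT⟩ := ih
    set R := B.filter fun b => ∀ t ∈ T, ¬ r b t with hR
    have hq : 0 ≤ 1 - d / n := by
      rw [sub_nonneg, div_le_one hn]
      exact hdn
    rcases R.eq_empty_or_nonempty with hR0 | ⟨b₀, hb₀⟩
    · refine ⟨T, hTA, hTk.trans k.le_succ, ?_⟩
      rw [← hR, hR0, card_empty, Nat.cast_zero]
      positivity
    have hA0 : A.Nonempty := by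
      have h1 := hd0.trans_le (hd b₀ (mem_filter.1 hb₀).1)
      obtain ⟨a, ha⟩ := card_pos.1 (Nat.cast_pos.1 h1)
      exact ⟨a, (mem_filter.1 ha).1⟩
    have hsum : ∑ b ∈ R, #(A.filter (r b)) = ∑ a ∈ A, #(R.filter fun b => r b a) :=
      sum_card_bipartiteAbove_eq_sum_card_bipartiteBelow r
    have h1 : (#R : ℝ) * d ≤ ∑ b ∈ R, (#(A.filter (r b)) : ℝ) := by
      rw [← nsmul_eq_mul]
      exact card_nsmul_le_sum _ _ _ fun b hb => hd b (mem_filter.1 hb).1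
    have h2 : ∑ b ∈ R, (#(A.filter (r b)) : ℝ) = ∑ a ∈ A, (#(R.filter fun b => r b a) : ℝ) := by
      exact_mod_cast hsum
    -- Averaging the at least `#R * d` pairs over at most `n` vertices of `A`.
    obtain ⟨a, ha, hRa⟩ := exists_le_of_sum_le (f := fun _ => (#R : ℝ) * d / n)
      (g := fun a => (#(R.filter fun b => r b a) : ℝ)) hA0 (by
        rw [sum_const, nsmul_eq_mul, ← h2]
        refine le_trans ?_ h1
        rw [mul_div_assoc', div_le_iff₀ hn, mul_comm]
        gcongr)
    refine ⟨insert a T, insert_subset ha hTA, (card_insert_le a T).trans (by omega), ?_⟩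
    have h3 : (B.filter fun b => ∀ t ∈ insert a T, ¬ r b t) = R.filter fun b => ¬ r b a := by
      ext b
      simp only [hR, mem_filter, forall_mem_insert]
      tauto
    have h4 : (#(R.filter fun b => r b a) : ℝ) + #(R.filter fun b => ¬ r b a) = #R := by
      exact_mod_cast card_filter_add_card_filter_not (s := R) (fun b => r b a)
    rw [h3]
    calc (#(R.filter fun b => ¬ r b a) : ℝ) ≤ #R * (1 - d / n) := by
          rw [mul_sub, mul_one, mul_div_assoc']
          linarith
      _ ≤ #B * (1 - d / n) ^ k * (1 - d / n) := by gcongr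
      _ = #B * (1 - d / n) ^ (k + 1) := by ring

/-- The `6` collects `4` from `#S`, `1` from rounding up the number of greedy steps (as `1 ≤ n / δ`)
and `1` from the vertices left over. -/
theorem rvc_le_log {δ : ℕ} (hG : G.Connected) (hδ : ∀ v, δ ≤ G.degree v) (h1 : 1 ≤ δ) :
    (rvc G : ℝ) ≤ (2 * Real.log δ + 6) * Fintype.card V / δ := by
  obtain ⟨v₀⟩ := hG.nonempty
  obtain ⟨S, hS, hbal, -, hout⟩ := exists_connectedOn_of_balance (α := 4) (β := δ) hG hδ h1
    (by omega) (connectedOn_singleton v₀)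
  have hcov₀ : cover G {v₀} = insert v₀ (G.neighborFinset v₀) := by
    ext; simp [cover]
  rw [hcov₀, card_insert_of_notMem (by simp), G.card_neighborFinset_eq_degree, card_singleton,
    mul_one] at hbal
  have hδ0 : (0 : ℝ) < δ := by exact_mod_cast h1
  have hδn : (δ : ℝ) ≤ Fintype.card V := by
    exact_mod_cast (hδ v₀).trans (G.degree_lt_card_verts v₀).le
  have hScard : (#S : ℝ) ≤ 4 * Fintype.card V / δ := by
    rw [le_div_iff₀ hδ0]
    have h2 := card_le_univ (cover G S)
    have h3 := hδ v₀
    have : #S * δ ≤ 4 * Fintype.card V := by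
      rw [mul_comm]
      omega
    exact_mod_cast this
  set n : ℝ := (Fintype.card V : ℝ) with hn
  have hn0 : 0 < n := hδ0.trans_le hδn
  have hdn : (δ : ℝ) / 2 ≤ n := by linarith
  have hdeg : ∀ w ∈ (cover G S)ᶜ, (δ : ℝ) / 2 ≤ #((cover G S).filter (G.Adj w)) := by
    intro w hw
    have h2 := (hout w (mem_compl.1 hw)).2
    have h3 := card_sdiff_add_card_inter (G.neighborFinset w) (cover G S)
    rw [G.card_neighborFinset_eq_degree] at h3
    have h4 : G.neighborFinset w ∩ cover G S = (cover G S).filter (G.Adj w) := by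
      ext; simp [and_comm]
    rw [h4] at h3
    have h5 := hδ w
    have : δ ≤ #((cover G S).filter (G.Adj w)) * 2 := by omega
    rw [div_le_iff₀ two_pos]
    exact_mod_cast this
  obtain ⟨T, hTS, hTk, hT⟩ := exists_dominating_greedy G.Adj (cover G S) (cover G S)ᶜ (n := n)
    (by rw [hn]; exact_mod_cast card_le_univ (cover G S)) (half_pos hδ0) hdn hdeg
    ⌈2 * n * Real.log δ / δ⌉₊
  set k := ⌈2 * n * Real.log δ / δ⌉₊ with hk
  set R := (cover G S)ᶜ.filter fun b => ∀ t ∈ T, ¬ G.Adj b t with hR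
  have hlog : 0 ≤ Real.log δ := Real.log_nonneg (by exact_mod_cast h1)
  have hq : 0 ≤ 1 - (δ : ℝ) / 2 / n := by
    rw [sub_nonneg, div_le_one hn0]
    exact hdn
  -- By `1 - t ≤ exp (-t)`, this `k` is just enough steps to leave a proportion `1 / δ`.
  have hpow : (1 - (δ : ℝ) / 2 / n) ^ k ≤ 1 / δ := by
    have hk' : 2 * n * Real.log δ / δ ≤ k := Nat.le_ceil _
    calc (1 - (δ : ℝ) / 2 / n) ^ k ≤ Real.exp (-((δ : ℝ) / 2 / n)) ^ k := by
          gcongr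
          exact Real.one_sub_le_exp_neg _
      _ = Real.exp (-(k * ((δ : ℝ) / 2 / n))) := by
          rw [← Real.exp_nat_mul, mul_neg]
      _ ≤ Real.exp (-Real.log δ) := by
          gcongr
          calc Real.log δ = 2 * n * Real.log δ / δ * ((δ : ℝ) / 2 / n) := by field_simp
            _ ≤ k * ((δ : ℝ) / 2 / n) := by gcongr
      _ = 1 / δ := by rw [Real.exp_neg, Real.exp_log hδ0, one_div]
  have hRcard : (#R : ℝ) ≤ n / δ := by
    have hT : (#R : ℝ) ≤ #(cover G S)ᶜ * (1 - (δ : ℝ) / 2 / n) ^ k := by convert hT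
    refine hT.trans ?_
    calc (#(cover G S)ᶜ : ℝ) * (1 - (δ : ℝ) / 2 / n) ^ k ≤ n * (1 / δ) :=
          mul_le_mul (by rw [hn]; exact_mod_cast card_le_univ (cover G S)ᶜ) hpow
            (pow_nonneg hq k) hn0.le
      _ = n / δ := by ring
  have hnear : ∀ w, ∃ v, w ∉ cover G S → v ∈ cover G S ∧ G.Adj w v := by
    intro w
    by_cases hw : w ∈ cover G S
    · exact ⟨w, fun h => absurd hw h⟩
    · obtain ⟨v, hv⟩ := (hout w hw).1
      exact ⟨v, fun _ => hv⟩
  choose f hf using hnear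
  have hRf : R.image f ⊆ cover G S := by
    intro v hv
    obtain ⟨w, hw, rfl⟩ := mem_image.1 hv
    exact (hf w (mem_compl.1 (mem_filter.1 hw).1)).1
  have hdom : cover G (S ∪ (T ∪ R.image f)) = univ := by
    refine eq_univ_iff_forall.2 fun w => ?_
    by_cases hw : w ∈ cover G S
    · exact cover_mono subset_union_left hw
    by_cases hwR : w ∈ R
    · exact mem_cover.2 (Or.inr ⟨f w, by simp only [mem_union, mem_image]; tauto, (hf w hw).2.symm⟩)
    · simp only [hR, mem_filter, mem_compl, hw, not_false_eq_true, true_and, not_forall,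
        not_not] at hwR
      obtain ⟨t, ht, hwt⟩ := hwR
      exact mem_cover.2 (Or.inr ⟨t, by simp [ht], hwt.symm⟩)
  have hfin := rvc_le_card_of_cover_eq_univ (hS.union_of_subset_cover (union_subset hTS hRf)) hdom
  have hsum : rvc G ≤ #S + (k + #R) :=
    hfin.trans ((card_union_le _ _).trans (Nat.add_le_add_left
      ((card_union_le _ _).trans (Nat.add_le_add hTk card_image_le)) _))
  have hkn : (k : ℝ) ≤ 2 * n * Real.log δ / δ + 1 :=
    (Nat.ceil_lt_add_one (by positivity)).le
  have hone : 1 ≤ n / δ := (one_le_div hδ0).2 hδn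
  calc (rvc G : ℝ) ≤ #S + (k + #R) := by exact_mod_cast hsum
    _ ≤ 4 * n / δ + ((2 * n * Real.log δ / δ + n / δ) + n / δ) := by linarith
    _ = (2 * Real.log δ + 6) * n / δ := by ring

end RainbowVertex

theorem theorem1 :
    (∀ (V : Type u) [Fintype V] (G : SimpleGraph V) [DecidableRel G.Adj], G.Connected →
      (G.minDegree = 3 →
        (RainbowVertex.rvc G : ℝ) ≤ 3 * (Fintype.card V : ℝ) / 4 - 2) ∧
      (G.minDegree = 4 →
        (RainbowVertex.rvc G : ℝ) ≤ 3 * (Fintype.card V : ℝ) / 5 - 8 / 5) ∧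
      (G.minDegree = 5 →
        (RainbowVertex.rvc G : ℝ) ≤ (Fintype.card V : ℝ) / 2 - 2)) ∧
    (∀ b : ℝ, 5 / 2 < b → ∃ δ₀ : ℕ, ∀ δ : ℕ, δ₀ ≤ δ →
      ∀ (V : Type u) [Fintype V] (G : SimpleGraph V) [DecidableRel G.Adj], G.Connected →
        G.minDegree = δ →
          (RainbowVertex.rvc G : ℝ) ≤ (b * Real.log (δ : ℝ)) * (Fintype.card V : ℝ) / (δ : ℝ)) := by
  classical
  constructor
  · intro V _ G _ hG
    refine ⟨fun h => ?_, fun h => ?_, fun h => ?_⟩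
    · have h1 : (4 * RainbowVertex.rvc G + 8 : ℝ) ≤ 3 * Fintype.card V := by
        exact_mod_cast RainbowVertex.rvc_le_of_three_le_degree hG
          fun v => h ▸ G.minDegree_le_degree v
      linarith
    · have h1 : (5 * RainbowVertex.rvc G + 8 : ℝ) ≤ 3 * Fintype.card V := by
        exact_mod_cast RainbowVertex.rvc_le_of_four_le_degree hG
          fun v => h ▸ G.minDegree_le_degree v
      linarith
    · have h1 : (2 * RainbowVertex.rvc G + 4 : ℝ) ≤ Fintype.card V := by
        exact_mod_cast RainbowVertex.rvc_le_of_five_le_degree hG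
          fun v => h ▸ G.minDegree_le_degree v
      linarith
  · intro b hb
    have hb2 : 0 < b - 2 := by linarith
    -- The threshold is where `6 ≤ (b - 2) * ln δ`; the argument only needs `b > 2`.
    refine ⟨⌈Real.exp (6 / (b - 2))⌉₊, fun δ hδ V _ G _ hG h => ?_⟩
    have hexp : Real.exp (6 / (b - 2)) ≤ δ := Nat.ceil_le.1 hδ
    have hδ0 : (0 : ℝ) < δ := (Real.exp_pos _).trans_le hexp
    have hlog : 6 / (b - 2) ≤ Real.log δ := (Real.le_log_iff_exp_le hδ0).2 hexp
    rw [div_le_iff₀ hb2] at hlog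
    refine (RainbowVertex.rvc_le_log hG (fun v => h ▸ G.minDegree_le_degree v)
      (by exact_mod_cast hδ0)).trans ?_
    gcongr
    linarith
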